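/- Let $\underline C=(C_i)_{i\in\Lambda}$, with $\Lambda$ countable, be a row contraction on a complex Hilbert space $\mathcal H_C$, i.e. $\sum_i C_iC_i^*\le \mathbf 1$. **Notation.** For a row contraction $\underline T$ on $\mathcal H$, regarded as an operator $\underline T:\bigoplus_{i\in\Lambda}\mathcal H\to\mathcal H$, let $D_T=(\mathbf 1-\underline T^*\underline T)^{1/2}$ on $\bigoplus_{i}\mathcal H$, let $\mathcal D_T=\overline{\operatorname{range} D_T}$, and let $D_{T,i}h=D_T(0,\dots,0,h,0,\dots,0)$ with $h$ in place $i$. Let $\Gamma$ be the full Fock space over $\ell^2(\Lambda)$, with vacuum vector $e_0$, orthonormal basis $e_\alpha$ ($\alpha$ a finite word in $\Lambda$), and creation operators $L_ix=e_i\otimes x$. The minimal isometric dilation of $\underline T$ is realized on $\hat{\mathcal H}_T=\mathcal H\oplus(\Gamma\otimes\mathcal D_T)$ by $$V^T_i(h\oplus x)=T_ih\oplus\big[e_0\otimes D_{T,i}h+(L_i\otimes\mathbf 1)x\big].$$ A *lifting* of $\underline C$ is a row contraction $\underline E=(E_i)_{i\in\Lambda}$ on a Hilbert space $\mathcal H_E=\mathcal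 H_C\oplus\mathcal H_A\supset\mathcal H_C$ with $P_{\mathcal H_C}E_i=C_iP_{\mathcal H_C}$ for all $i$. It is *subisometric* if there is a unitary $W:\hat{\mathcal H}_E\to\hat{\mathcal H}_C$ with $W|_{\mathcal H_C}=\mathbf 1$ and $WV_i^E=V_i^CW$ for all $i$. Liftings $\underline E,\underline E'$ are *unitarily equivalent* if there is a unitary $u:\mathcal H_E\to\mathcal H_{E'}$ with $u|_{\mathcal H_C}=\mathbf 1$ and $uE_i=E_i'u$ for all $i$. A *multi-analytic inner operator* is an isometry $M:\Gamma\otimes\mathcal D\to\Gamma\otimes\mathcal D_C$ ($\mathcal D$ some Hilbert space) with $M(L_i\otimes\mathbf 1)=(L_i\otimes\mathbf 1)M$ for all $i$; its *symbol* is $\Theta:\mathcal D\to\Gamma\otimes\mathcal D_C$, $\Theta d=M(e_0\otimes d)$. Two of them are *equivalent* if $\Theta=\Theta'v$ for some unitary $v:\mathcal D\to\mathcal D'$. For a subisometric lifting $\underline E$ with unitary $W$, the *characteristic function* is the multi-analytic inner operator $M_{C,E}=W|_{\Gamma\otimes\mathcal D_E}:\Gamma\otimes\mathcal D_E\to\Gamma\otimes\mathcal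 D_C$. **Theorem.** There are one-to-one correspondences between - (a) unitary equivalence classes of subisometric liftings $\underline E$ of $\underline C$, - (b) closed subspaces $\mathcal N$ of $\Gamma\otimes\mathcal D_C$ that are invariant under $L_i\otimes\mathbf 1$ for all $i\in\Lambda$, - (c) equivalence classes of multi-analytic inner operators $M:\Gamma\otimes\mathcal D\to\Gamma\otimes\mathcal D_C$, given as follows, and compatible with each other. (a)$\to$(b) sends the class of $\underline E$ to $\mathcal N=(\Gamma\otimes\mathcal D_C)\ominus W\mathcal H_A$; its inverse sends $\mathcal N$ to the class of the compression of $\underline V^C$ to $\mathcal H_C\oplus\big((\Gamma\otimes\mathcal D_C)\ominus\mathcal N\big)$. (c)$\to$(b) sends the class of $M$ to $M(\Gamma\otimes\mathcal D)$. (a)$\to$(c) sends the class of $\underline E$ to the class of $M_{C,E}$; in particular $\mathcal N=M_{C,E}(\Gamma\otimes\mathcal D_E)$. Consequently two subisometric liftings $\underline E,\underline E'$ of $\underline C$ are unitarily equivalent if and only if $M_{C,E}$ and $M_{C,E'}$ are equivalent. -/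

import Mathlib

open scoped InnerProductSpace InnerProduct

universe u

noncomputable section

namespace Subisometric

/-! ### Row contractions and their defect spaces -/

/-- A row contraction on the Hilbert space `H`, indexed by `ι`: a tuple of bounded operators with
`∑ i, T i * (T i)† ≤ 1`.  For an infinite tuple the sum is a strong limit of its (increasing)
finite partial sums, so that the inequality says that every finite partial sum is `≤ 1`. -/
structure RowContraction (ι : Type) (H : Type u) [NormedAddCommGroup H] [InnerProductSpace ℂ H]
    [CompleteSpace H] where
  op : ι → H →L[ℂ] H
  sum_le_one : ∀ s : Finset ι, ∑ i ∈ s, op i ∘L (op i)† ≤ 1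

/-- The Hilbert space direct sum of copies of `H` indexed by `ι`. -/
abbrev HSum (ι : Type) (H : Type u) [NormedAddCommGroup H] [InnerProductSpace ℂ H] : Type u :=
  lp (fun _ : ι => H) 2

namespace RowContraction

variable {ι : Type} {H : Type u} [NormedAddCommGroup H] [InnerProductSpace ℂ H] [CompleteSpace H]

theorem sum_norm_adjoint_sq_le (T : RowContraction ι H) (s : Finset ι) (h : H) :
    ∑ i ∈ s, ‖((T.op i)†) h‖ ^ 2 ≤ ‖h‖ ^ 2 := by
  have h1 := ((ContinuousLinearMap.le_def _ _).1 (T.sum_le_one s)).re_inner_nonneg_left h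
  have h2 : ∀ i, RCLike.re ⟪T.op i (((T.op i)†) h), h⟫_ℂ = ‖((T.op i)†) h‖ ^ 2 := by
    intro i
    rw [← ContinuousLinearMap.adjoint_inner_right, inner_self_eq_norm_sq]
  simp only [sub_apply, one_apply_eq_self, inner_sub_left, sum_apply, ContinuousLinearMap.comp_apply, sum_inner, map_sub, map_sum,
    h2, inner_self_eq_norm_sq] at h1
  linarith

/-- The column operator `h ↦ ((T i)† h)_i`. -/
def column (T : RowContraction ι H) : H →L[ℂ] HSum ι H :=
  LinearMap.mkContinuous
    { toFun := fun h => ⟨fun i => ((T.op i)†) h, memℓp_gen' (C := ‖h‖ ^ 2) (by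
        intro s
        simpa using T.sum_norm_adjoint_sq_le s h)⟩
      map_add' := fun x y => by
        ext i
        exact map_add _ x y
      map_smul' := fun c x => by
        ext i
        exact map_smul _ c x }
    1 (by
      intro h
      rw [one_mul]
      refine lp.norm_le_of_forall_sum_le (by simp) (norm_nonneg h) (fun s => ?_)
      simpa using T.sum_norm_adjoint_sq_le s h)

@[simp] theorem column_apply (T : RowContraction ι H) (h : H) (i : ι) :
    T.column h i = ((T.op i)†) h := rfl

/-- The row operator `(h_i)_i ↦ ∑ i, T i h_i`, from the direct sum of copies of `H` to `H`. -/
def row (T : RowContraction ι H) : HSum ι H →L[ℂ] H := (T.column)†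

open Classical in
theorem row_single (T : RowContraction ι H) (i : ι) (h : H) :
    T.row (lp.single 2 i h) = T.op i h := by
  refine ext_inner_right ℂ fun y => ?_
  rw [row, ContinuousLinearMap.adjoint_inner_left, lp.inner_single_left, column_apply,
    ContinuousLinearMap.adjoint_inner_right]

/-- The positive square root of a positive operator on a Hilbert space. -/
def posSqrt {K : Type u} [NormedAddCommGroup K] [InnerProductSpace ℂ K] [CompleteSpace K]
    (A : K →L[ℂ] K) : K →L[ℂ] K := CFC.sqrt A

/-- The defect operator `D = (1 - T* T)^{1/2}` on the direct sum of copies of `H`. -/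
def defectOp (T : RowContraction ι H) : HSum ι H →L[ℂ] HSum ι H :=
  posSqrt (1 - (T.row)† ∘L T.row)

/-- The defect space `𝒟`: the closure of the range of the defect operator. -/
def defectSpace (T : RowContraction ι H) : Submodule ℂ (HSum ι H) :=
  (LinearMap.range (T.defectOp : HSum ι H →ₗ[ℂ] HSum ι H)).topologicalClosure

/-- The defect space as a Hilbert space. -/
abbrev Defect (T : RowContraction ι H) : Type u := T.defectSpace

instance (T : RowContraction ι H) : CompleteSpace T.Defect :=
  (Submodule.isClosed_topologicalClosure _).completeSpace_coe

open Classical in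
/-- `D_i h = D (0, …, 0, h, 0, …, 0)` with `h` in the place `i`, as an operator into `𝒟`. -/
def defectComp (T : RowContraction ι H) (i : ι) : H →L[ℂ] T.Defect :=
  (T.defectOp ∘L lp.singleContinuousLinearMap ℂ (fun _ : ι => H) 2 i).codRestrict T.defectSpace
    (fun _ => Submodule.le_topologicalClosure _ (LinearMap.mem_range_self _ _))

end RowContraction

/-! ### The full Fock space with coefficients -/

/-- The Hilbert space `Γ ⊗ Y`, where `Γ` is the full Fock space of `ℓ²(ι)`.  The vectors `e_α`,
with `α` running through the finite words in `ι`, form an orthonormal basis of `Γ`, and an element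
`∑ α, e_α ⊗ y_α` of `Γ ⊗ Y` is given by its square summable family of coefficients `y_α`. -/
abbrev Fock (ι : Type) (Y : Type u) [NormedAddCommGroup Y] [InnerProductSpace ℂ Y] : Type u :=
  lp (fun _ : List ι => Y) 2

section Fock

variable {ι : Type} {Y : Type u} [NormedAddCommGroup Y] [InnerProductSpace ℂ Y]

set_option linter.unusedSectionVars false

open Classical in
/-- The vector `e_α ⊗ y`. -/
def tens (α : List ι) (y : Y) : Fock ι Y := lp.single 2 α y

/-- The embedding `y ↦ e_0 ⊗ y`, where `e_0` is the vacuum vector. -/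
def vac (ι : Type) (Y : Type u) [NormedAddCommGroup Y] [InnerProductSpace ℂ Y] :
    Y →L[ℂ] Fock ι Y :=
  open Classical in lp.singleContinuousLinearMap ℂ (fun _ : List ι => Y) 2 []

theorem vac_apply (y : Y) : vac ι Y y = tens [] y := rfl

open Classical in
/-- The coefficients of `(L i ⊗ 1) x`: since `e_i ⊗ e_β = e_{iβ}`, the coefficient of the word `iβ`
is `x_β`, and the words that do not start with `i` have coefficient `0`. -/
def creationFun (i : ι) (x : List ι → Y) : List ι → Y
  | [] => 0
  | j :: β => if j = i then x β else 0

open Classical in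
theorem creationFun_eq_extend (i : ι) (x : List ι → Y) :
    creationFun i x = Function.extend (List.cons i) x 0 := by
  have hinj : Function.Injective (List.cons i) := List.cons_injective
  funext α
  match α with
  | [] =>
    rw [Function.extend_apply' _ _ _ (by rintro ⟨β, hβ⟩; simp at hβ)]
    rfl
  | j :: β =>
    by_cases hj : j = i
    · subst hj
      rw [hinj.extend_apply]
      simp [creationFun]
    · rw [Function.extend_apply' _ _ _ (by
        rintro ⟨γ, hγ⟩
        exact hj (List.cons.inj hγ).1.symm)]
      simp [creationFun, hj]

theorem hasSum_creationFun (i : ι) (x : List ι → Y) (a : ℝ)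
    (hx : HasSum (fun β => ‖x β‖ ^ 2) a) : HasSum (fun α => ‖creationFun i x α‖ ^ 2) a := by
  have hinj : Function.Injective (List.cons i) := List.cons_injective
  have h := (hasSum_extend_zero hinj).2 hx
  convert h using 1
  funext α
  rw [creationFun_eq_extend]
  by_cases hα : ∃ β, i :: β = α
  · obtain ⟨β, rfl⟩ := hα
    rw [hinj.extend_apply, hinj.extend_apply]
  · rw [Function.extend_apply' _ _ _ hα, Function.extend_apply' _ _ _ hα]
    simp

/-- The operator `L i ⊗ 1` on `Γ ⊗ Y`, where `L i` is the (left) creation operator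
`x ↦ e_i ⊗ x` on `Γ`. -/
def creation (i : ι) : Fock ι Y →ₗᵢ[ℂ] Fock ι Y where
  toFun x := ⟨creationFun i x, by
    have h2 : Summable fun β => ‖x β‖ ^ 2 := by
      simpa using (lp.memℓp x).summable (by simp)
    exact memℓp_gen (by simpa using (hasSum_creationFun i x _ h2.hasSum).summable)⟩
  map_add' x y := by
    ext α
    match α with
    | [] =>
      change (0 : Y) = 0 + 0
      simp
    | j :: β =>
      change creationFun i (x + y) (j :: β) = creationFun i x (j :: β) + creationFun i y (j :: β)
      by_cases hj : j = i <;> simp [creationFun, hj]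
  map_smul' c x := by
    ext α
    match α with
    | [] => simp [creationFun]
    | j :: β => by_cases hj : j = i <;> simp [creationFun, hj]
  norm_map' x := by
    have h2 : Summable fun β => ‖x β‖ ^ 2 := by
      simpa using (lp.memℓp x).summable (by simp)
    have h3 := hasSum_creationFun i x _ h2.hasSum
    rw [lp.norm_eq_tsum_rpow (by simp), lp.norm_eq_tsum_rpow (by simp)]
    congr 1
    simpa using h3.tsum_eq

theorem creation_tens (i : ι) (α : List ι) (y : Y) :
    creation i (tens α y) = tens (i :: α) y := by
  classical
  ext β
  change creationFun i (tens α y) β = tens (i :: α) y β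
  match β with
  | [] => simp [creationFun, tens, lp.single_apply]
  | j :: γ =>
    by_cases hj : j = i
    · subst hj
      by_cases hγ : γ = α
      · subst hγ; simp [creationFun, tens]
      · simp [creationFun, tens, lp.single_apply, hγ]
    · simp [creationFun, tens, lp.single_apply, hj]

end Fock

/-! ### The minimal isometric dilation -/

namespace RowContraction

variable {ι : Type} {H : Type u} [NormedAddCommGroup H] [InnerProductSpace ℂ H] [CompleteSpace H]

/-- The space `H ⊕ (Γ ⊗ 𝒟)` of the minimal isometric dilation. -/
abbrev MidSpace (T : RowContraction ι H) : Type u := WithLp 2 (H × Fock ι T.Defect)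

/-- The minimal isometric dilation of `T`, in Popescu's form of the Schäffer construction:
`V i (h ⊕ x) = T i h ⊕ (e_0 ⊗ D_i h + (L i ⊗ 1) x)`. -/
def mid (T : RowContraction ι H) (i : ι) : T.MidSpace →L[ℂ] T.MidSpace :=
  (WithLp.prodContinuousLinearEquiv 2 ℂ H (Fock ι T.Defect)).symm.toContinuousLinearMap ∘L
    ((T.op i ∘L WithLp.fstL 2 ℂ H (Fock ι T.Defect)).prod
      (vac ι T.Defect ∘L T.defectComp i ∘L WithLp.fstL 2 ℂ H (Fock ι T.Defect) +
        (creation i).toContinuousLinearMap ∘L WithLp.sndL 2 ℂ H (Fock ι T.Defect)))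

theorem mid_apply (T : RowContraction ι H) (i : ι) (h : H) (x : Fock ι T.Defect) :
    T.mid i (WithLp.toLp 2 (h, x)) =
      WithLp.toLp 2 (T.op i h, vac ι T.Defect (T.defectComp i h) + creation i x) := rfl

end RowContraction

/-! ### Liftings -/

section Lifting

variable {ι : Type} {H : Type u} [NormedAddCommGroup H] [InnerProductSpace ℂ H] [CompleteSpace H]

/-- A lifting `E` of the row contraction `C` on `H`: a row contraction on a Hilbert space that
contains `H` (through the isometric embedding `emb`) with `P E_i = C_i P`, where `P = emb†` is the
orthogonal projection onto `H`.  Equivalently, `E_i` has the block matrix `[C_i, 0; B_i, A_i]` with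
respect to the decomposition `H ⊕ H^⊥`. -/
structure Lifting (C : RowContraction ι H) where
  Space : Type u
  [normedAddCommGroup : NormedAddCommGroup Space]
  [innerProductSpace : InnerProductSpace ℂ Space]
  [completeSpace : CompleteSpace Space]
  row : RowContraction ι Space
  emb : H →ₗᵢ[ℂ] Space
  proj_comp : ∀ i, (emb.toContinuousLinearMap)† ∘L row.op i =
    C.op i ∘L (emb.toContinuousLinearMap)†

attribute [instance] Lifting.normedAddCommGroup Lifting.innerProductSpace Lifting.completeSpace

variable {C : RowContraction ι H}

/-- A unitary `W` from the space of the minimal isometric dilation of `E` onto that of `C`, which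
is the identity on `H` and intertwines the dilations. -/
structure Intertwiner (E : Lifting C) where
  W : E.row.MidSpace ≃ₗᵢ[ℂ] C.MidSpace
  map_emb : ∀ h : H, W (WithLp.toLp 2 (E.emb h, 0)) = WithLp.toLp 2 (h, 0)
  comm : ∀ (i : ι) (x : E.row.MidSpace), W (E.row.mid i x) = C.mid i (W x)

/-- A lifting is subisometric if the minimal isometric dilations are unitarily equivalent through
a unitary that is the identity on `H`. -/
def Lifting.IsSubisometric (E : Lifting C) : Prop := Nonempty (Intertwiner E)

/-- Unitary equivalence of liftings of `C`. -/
def Lifting.UnitarilyEquivalent (E E' : Lifting C) : Prop :=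
  ∃ u : E.Space ≃ₗᵢ[ℂ] E'.Space, (∀ h : H, u (E.emb h) = E'.emb h) ∧
    ∀ (i : ι) (x : E.Space), u (E.row.op i x) = E'.row.op i (u x)

/-- Subisometric liftings of `C`. -/
def SubisometricLifting (C : RowContraction ι H) : Type (u + 1) :=
  {E : Lifting C // E.IsSubisometric}

/-- Unitary equivalence as an equivalence relation on the subisometric liftings of `C`. -/
instance liftingSetoid (C : RowContraction ι H) : Setoid (SubisometricLifting C) where
  r E E' := E.1.UnitarilyEquivalent E'.1
  iseqv :=
    { refl := fun E => ⟨LinearIsometryEquiv.refl ℂ _, fun _ => rfl, fun _ _ => rfl⟩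
      symm := by
        rintro E E' ⟨u, hu, hc⟩
        refine ⟨u.symm, fun h => ?_, fun i x => ?_⟩
        · rw [← hu, u.symm_apply_apply]
        · rw [LinearIsometryEquiv.symm_apply_eq, hc, u.apply_symm_apply]
      trans := by
        rintro E E' E'' ⟨u, hu, hc⟩ ⟨u', hu', hc'⟩
        exact ⟨u.trans u', fun h => by simp [hu, hu'], fun i x => by simp [hc, hc']⟩ }

/-! ### Invariant subspaces -/

/-- The (closed) subspaces of `Γ ⊗ Y` that are invariant for all `L i ⊗ 1`. -/
def InvariantSubspace (ι : Type) (Y : Type u) [NormedAddCommGroup Y] [InnerProductSpace ℂ Y] :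
    Type u :=
  {N : Submodule ℂ (Fock ι Y) // IsClosed (N : Set (Fock ι Y)) ∧
    ∀ (i : ι), ∀ x ∈ N, creation i x ∈ N}

/-- The subspace `H_A = H_E ⊖ H` of the space of a lifting `E`. -/
def Lifting.complement (E : Lifting C) : Submodule ℂ E.Space :=
  (LinearMap.range E.emb.toLinearMap)ᗮ

theorem Intertwiner.fst_W_eq_zero {E : Lifting C} (w : Intertwiner E) (x : E.row.MidSpace)
    (hx : ∀ h : H, ⟪E.emb h, x.fst⟫_ℂ = 0) : (w.W x).fst = 0 := by
  refine ext_inner_left ℂ fun h => ?_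
  have h1 : ⟪w.W (WithLp.toLp 2 (E.emb h, 0)), w.W x⟫_ℂ = 0 := by
    rw [LinearIsometryEquiv.inner_map_map, WithLp.prod_inner_apply]
    simpa using hx h
  rw [w.map_emb, WithLp.prod_inner_apply] at h1
  simpa using h1

/-- The operator `x ↦ W x` from `H_E` to `Γ ⊗ 𝒟_C`, followed by the projection of `H_C ⊕ (Γ ⊗ 𝒟_C)`
to its second component.  On `H_A` the projection does nothing. -/
def Intertwiner.onSpace {E : Lifting C} (w : Intertwiner E) : E.Space →ₗ[ℂ] Fock ι C.Defect where
  toFun a := (w.W (WithLp.toLp 2 (a, 0))).snd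
  map_add' a b := by
    rw [← WithLp.add_snd, ← map_add, ← WithLp.toLp_add, Prod.mk_add_mk, add_zero]
  map_smul' c a := by
    rw [RingHom.id_apply, ← WithLp.smul_snd, ← map_smul, ← WithLp.toLp_smul, Prod.smul_mk,
      smul_zero]

theorem Intertwiner.W_complement {E : Lifting C} (w : Intertwiner E) (a : E.Space)
    (ha : a ∈ E.complement) :
    w.W (WithLp.toLp 2 (a, 0)) = WithLp.toLp 2 (0, w.onSpace a) := by
  have h0 : (w.W (WithLp.toLp 2 (a, 0))).fst = 0 :=
    w.fst_W_eq_zero _ fun h => (Submodule.mem_orthogonal _ _).1 ha _ ⟨h, rfl⟩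
  calc w.W (WithLp.toLp 2 (a, 0))
      = WithLp.toLp 2 ((w.W (WithLp.toLp 2 (a, 0))).fst, (w.W (WithLp.toLp 2 (a, 0))).snd) := rfl
    _ = WithLp.toLp 2 (0, w.onSpace a) := by rw [h0]; rfl

/-- The invariant subspace `𝒩 = (Γ ⊗ 𝒟_C) ⊖ W H_A` associated to a subisometric lifting. -/
def Intertwiner.invariantSubspace {E : Lifting C} (w : Intertwiner E) :
    Submodule ℂ (Fock ι C.Defect) :=
  (E.complement.map w.onSpace)ᗮ

/-! ### The lifting constructed from an invariant subspace -/

/-- The subspace `H_* = H ⊕ ((Γ ⊗ 𝒟_C) ⊖ 𝒩)` of `H ⊕ (Γ ⊗ 𝒟_C)`. -/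
def modelSpace (C : RowContraction ι H) (N : Submodule ℂ (Fock ι C.Defect)) :
    Submodule ℂ C.MidSpace :=
  Nᗮ.comap (WithLp.sndL 2 ℂ H (Fock ι C.Defect)).toLinearMap

instance (C : RowContraction ι H) (N : Submodule ℂ (Fock ι C.Defect)) :
    CompleteSpace (modelSpace C N) :=
  (N.isClosed_orthogonal.preimage
    (WithLp.sndL 2 ℂ H (Fock ι C.Defect)).continuous).completeSpace_coe

/-- The lifting `E` of `C` is unitarily equivalent, by a unitary that is the identity on `H`, to the
tuple of compressions of the minimal isometric dilation of `C` to `H ⊕ ((Γ ⊗ 𝒟_C) ⊖ 𝒩)`. -/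
def Lifting.HasModel (E : Lifting C) (N : Submodule ℂ (Fock ι C.Defect)) : Prop :=
  ∃ u : E.Space ≃ₗᵢ[ℂ] modelSpace C N,
    (∀ h : H, (u (E.emb h) : C.MidSpace) = WithLp.toLp 2 (h, 0)) ∧
    ∀ (i : ι) (x : E.Space),
      u (E.row.op i x) = (modelSpace C N).orthogonalProjectionOnto (C.mid i (u x))

end Lifting

/-! ### Multi-analytic inner operators and characteristic functions -/

/-- A multi-analytic inner operator `M : Γ ⊗ 𝒟 → Γ ⊗ Y`, for some Hilbert space `𝒟`: an isometry
with `M (L i ⊗ 1) = (L i ⊗ 1) M` for all `i`. -/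
structure MultiAnalyticInner (ι : Type) (Y : Type u) [NormedAddCommGroup Y]
    [InnerProductSpace ℂ Y] where
  Dom : Type u
  [normedAddCommGroup : NormedAddCommGroup Dom]
  [innerProductSpace : InnerProductSpace ℂ Dom]
  [completeSpace : CompleteSpace Dom]
  M : Fock ι Dom →ₗᵢ[ℂ] Fock ι Y
  comm : ∀ (i : ι) (x : Fock ι Dom), M (creation i x) = creation i (M x)

attribute [instance] MultiAnalyticInner.normedAddCommGroup MultiAnalyticInner.innerProductSpace
  MultiAnalyticInner.completeSpace

section Characteristic

variable {ι : Type}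

section

variable {Y : Type u} [NormedAddCommGroup Y] [InnerProductSpace ℂ Y]

/-- The symbol `Θ : 𝒟 → Γ ⊗ Y`, `Θ d = M (e_0 ⊗ d)`. -/
def MultiAnalyticInner.symbol (M : MultiAnalyticInner ι Y) : M.Dom →L[ℂ] Fock ι Y :=
  M.M.toContinuousLinearMap ∘L vac ι M.Dom

/-- Equivalence of multi-analytic inner operators: `Θ = Θ' v` with a unitary `v : 𝒟 → 𝒟'`. -/
instance multiAnalyticSetoid (ι : Type) (Y : Type u) [NormedAddCommGroup Y]
    [InnerProductSpace ℂ Y] : Setoid (MultiAnalyticInner ι Y) where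
  r M M' := ∃ v : M.Dom ≃ₗᵢ[ℂ] M'.Dom, ∀ d : M.Dom, M.symbol d = M'.symbol (v d)
  iseqv :=
    { refl := fun M => ⟨LinearIsometryEquiv.refl ℂ _, fun _ => rfl⟩
      symm := by
        rintro M M' ⟨v, hv⟩
        exact ⟨v.symm, fun d => by rw [hv, v.apply_symm_apply]⟩
      trans := by
        rintro M M' M'' ⟨v, hv⟩ ⟨v', hv'⟩
        exact ⟨v.trans v', fun d => by rw [hv, hv']; rfl⟩ }

end

variable {H : Type u} [NormedAddCommGroup H] [InnerProductSpace ℂ H] [CompleteSpace H]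
  {C : RowContraction ι H}

theorem Intertwiner.W_fock {E : Lifting C} (w : Intertwiner E) (x : Fock ι E.row.Defect) :
    w.W (WithLp.toLp 2 (0, x)) =
      WithLp.toLp 2 (0, (w.W (WithLp.toLp 2 (0, x))).snd) := by
  have h0 : (w.W (WithLp.toLp 2 (0, x))).fst = 0 := w.fst_W_eq_zero _ fun h => by simp
  calc w.W (WithLp.toLp 2 (0, x))
      = WithLp.toLp 2 ((w.W (WithLp.toLp 2 (0, x))).fst, (w.W (WithLp.toLp 2 (0, x))).snd) := rfl
    _ = _ := by rw [h0]

/-- The characteristic function of a subisometric lifting `E`: the multi-analytic inner operator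
`M_{C,E} : Γ ⊗ 𝒟_E → Γ ⊗ 𝒟_C` that is the restriction of `W` to `Γ ⊗ 𝒟_E`. -/
def Intertwiner.charFun {E : Lifting C} (w : Intertwiner E) : MultiAnalyticInner ι C.Defect where
  Dom := E.row.Defect
  M :=
    { toFun := fun x => (w.W (WithLp.toLp 2 (0, x))).snd
      map_add' := fun x y => by
        rw [← WithLp.add_snd, ← map_add, ← WithLp.toLp_add, Prod.mk_add_mk, add_zero]
      map_smul' := fun c x => by
        rw [RingHom.id_apply, ← WithLp.smul_snd, ← map_smul, ← WithLp.toLp_smul, Prod.smul_mk,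
          smul_zero]
      norm_map' := fun x => by
        change ‖(w.W (WithLp.toLp 2 (0, x))).snd‖ = ‖x‖
        have h1 := w.W.norm_map (WithLp.toLp 2 (0, x))
        rw [w.W_fock x] at h1
        simpa using h1 }
  comm := fun i x => by
    change (w.W (WithLp.toLp 2 (0, creation i x))).snd =
      creation i (w.W (WithLp.toLp 2 (0, x))).snd
    have h1 : (WithLp.toLp 2 (0, creation i x) : E.row.MidSpace) =
        E.row.mid i (WithLp.toLp 2 (0, x)) := by
      rw [RowContraction.mid_apply]; simp
    rw [h1, w.comm, w.W_fock x, RowContraction.mid_apply]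
    simp

end Characteristic

end Subisometric

end

noncomputable section

namespace Subisometric

/-! ### Hilbert sums and Fock spaces -/

/-! The class of a subisometric lifting `E` is encoded by the position of `W H_E` in the dilation
space of `C`. Since `W` is unitary, `W (Γ ⊗ 𝒟_E)` is the orthogonal complement of `W H_E`. Hence the
range of `M_{C,E}` is `𝒩` (`range_charFun`), and `W H_E` is the model space `H ⊕ 𝒩ᗮ`
(`range_spaceIsometry`). As `E_i` is the compression of its own dilation to `H_E`, transport by `W`
makes it the compression of `V_i^C` to the model space (`Intertwiner.hasModel`), so `𝒩` determines
the class. Conversely, minimality of the dilation of `C` shows that an equivalence `u` satisfies `W'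
u = W` on `H_E` (`spaceIsometry_eq`). So the class determines `𝒩`, whichever `W` is chosen.

For existence, compress `V^C` to `K = H ⊕ 𝒩ᗮ`. By Pythagoras, the part of `∑ V_i k_i` orthogonal to
`K` has the norm of the defect operator at `(k_i)`. So the defect space embeds isometrically into
`𝒩`, orthogonally to every `(L_i ⊗ 1) 𝒩` (`exists_model_symbol`). Translating this wandering
subspace by words gives a multi-analytic inner operator `M`. The sum of the inclusion of `K` and `M`
is an isometric intertwiner, onto by minimality (`exists_intertwiner_of_symbol`).

A multi-analytic inner operator is recovered up to equivalence from its range, because `e_0 ⊗ 𝒟` is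
what is orthogonal to the translates of the range (`equiv_of_range_eq`). That every `𝒩` is such a
range needs no separate Wold decomposition: the characteristic function of the lifting built from
`𝒩` provides it. -/

theorem mem_of_forall_single_mem {κ : Type} [DecidableEq κ] {Y : Type u} [NormedAddCommGroup Y]
    [InnerProductSpace ℂ Y] {S : Submodule ℂ (lp (fun _ : κ => Y) 2)}
    (hS : IsClosed (S : Set (lp (fun _ : κ => Y) 2))) (h : ∀ k y, lp.single 2 k y ∈ S)
    (x : lp (fun _ : κ => Y) 2) : x ∈ S :=
  hS.mem_of_tendsto (lp.hasSum_single (by simp) x)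
    (Filter.Eventually.of_forall fun _ => S.sum_mem fun _ _ => h _ _)

section Fock

variable {ι : Type} {Y : Type u} [NormedAddCommGroup Y] [InnerProductSpace ℂ Y]

theorem mem_of_forall_tens_mem {S : Submodule ℂ (Fock ι Y)} (hS : IsClosed (S : Set (Fock ι Y)))
    (h : ∀ α y, tens α y ∈ S) (x : Fock ι Y) : x ∈ S := by
  classical
  exact mem_of_forall_single_mem hS h x

theorem fock_ext {Z : Type u} [NormedAddCommGroup Z] [InnerProductSpace ℂ Z]
    {f g : Fock ι Y →L[ℂ] Z} (h : ∀ α y, f (tens α y) = g (tens α y)) : f = g := by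
  ext1 x
  exact mem_of_forall_tens_mem (S := LinearMap.eqLocus f.toLinearMap g.toLinearMap)
    (isClosed_eq f.continuous g.continuous) h x

theorem creation_apply_nil (i : ι) (x : Fock ι Y) : creation i x [] = 0 := rfl

theorem creation_apply_cons_of_ne {i j : ι} (h : j ≠ i) (x : Fock ι Y) (β : List ι) :
    creation i x (j :: β) = 0 := by
  change creationFun i x (j :: β) = 0
  simp [creationFun, h]

theorem inner_creation_of_ne {i j : ι} (h : i ≠ j) (x y : Fock ι Y) :
    ⟪creation i x, creation j y⟫_ℂ = 0 := by
  rw [lp.inner_eq_tsum]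
  refine (tsum_congr fun α => ?_).trans tsum_zero
  match α with
  | [] => rw [creation_apply_nil, inner_zero_left]
  | k :: β =>
    by_cases hk : k = i
    · rw [creation_apply_cons_of_ne (i := j) (by rw [hk]; exact h), inner_zero_right]
    · rw [creation_apply_cons_of_ne hk, inner_zero_left]

theorem inner_tens_left (α : List ι) (y : Y) (x : Fock ι Y) : ⟪tens α y, x⟫_ℂ = ⟪y, x α⟫_ℂ := by
  classical
  exact lp.inner_single_left (G := fun _ : List ι => Y) (𝕜 := ℂ) α y x

theorem inner_vac_left (y : Y) (x : Fock ι Y) : ⟪vac ι Y y, x⟫_ℂ = ⟪y, x []⟫_ℂ :=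
  inner_tens_left [] y x

theorem vac_apply_nil (y : Y) : vac ι Y y [] = y := by
  classical
  exact lp.single_apply_self (E := fun _ : List ι => Y) 2 [] y

theorem inner_vac_creation (y : Y) (i : ι) (x : Fock ι Y) : ⟪vac ι Y y, creation i x⟫_ℂ = 0 := by
  rw [inner_vac_left, creation_apply_nil, inner_zero_right]

theorem inner_vac_vac (y z : Y) : ⟪vac ι Y y, vac ι Y z⟫_ℂ = ⟪y, z⟫_ℂ := by
  rw [inner_vac_left, vac_apply_nil]

theorem norm_vac (y : Y) : ‖vac ι Y y‖ = ‖y‖ := by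
  rw [@norm_eq_sqrt_re_inner ℂ, @norm_eq_sqrt_re_inner ℂ, inner_vac_vac]

/-- A vector that is orthogonal to the ranges of all creation operators is of the form
`e_0 ⊗ y`. -/
theorem eq_vac_of_inner_creation_eq_zero {x : Fock ι Y}
    (h : ∀ (i : ι) (z : Fock ι Y), ⟪creation i z, x⟫_ℂ = 0) : x = vac ι Y (x []) := by
  classical
  ext α
  match α with
  | [] => rw [vac_apply_nil]
  | i :: β =>
    have h1 : x (i :: β) = 0 := by
      have := h i (tens β (x (i :: β)))
      rwa [creation_tens, inner_tens_left, inner_self_eq_zero] at this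
    rw [h1]
    exact (lp.single_apply_ne (E := fun _ : List ι => Y) 2 [] _ (List.cons_ne_nil i β)).symm

/-! ### Wandering subspaces and multi-analytic operators -/

/-- The isometry `L α ⊗ 1` on `Γ ⊗ Y`, for a word `α`. -/
def creationWord : List ι → Fock ι Y →ₗᵢ[ℂ] Fock ι Y
  | [] => LinearIsometry.id
  | i :: α => (creation i).comp (creationWord α)

theorem creationWord_cons (i : ι) (α : List ι) (x : Fock ι Y) :
    creationWord (i :: α) x = creation i (creationWord α x) := rfl

theorem creationWord_mem {N : Submodule ℂ (Fock ι Y)}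
    (hN : ∀ (i : ι), ∀ x ∈ N, creation i x ∈ N) (α : List ι) {x : Fock ι Y} (hx : x ∈ N) :
    creationWord α x ∈ N := by
  induction α with
  | nil => exact hx
  | cons i α ih => exact hN i _ ih

/-- The translates of a wandering subspace by distinct words are orthogonal. -/
theorem inner_creationWord_of_ne {N : Submodule ℂ (Fock ι Y)}
    (hN : ∀ (i : ι), ∀ x ∈ N, creation i x ∈ N) {x y : Fock ι Y} (hx : x ∈ N) (hy : y ∈ N)
    (hx' : ∀ (i : ι), ∀ z ∈ N, ⟪creation i z, x⟫_ℂ = 0)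
    (hy' : ∀ (i : ι), ∀ z ∈ N, ⟪creation i z, y⟫_ℂ = 0) {α β : List ι} (h : α ≠ β) :
    ⟪creationWord α x, creationWord β y⟫_ℂ = 0 := by
  induction α generalizing β with
  | nil =>
    match β with
    | [] => exact absurd rfl h
    -- A nontrivial translate of `y` lies in `(L_j ⊗ 1) N`, to which `x` is orthogonal. The general
    -- case reduces to this one by cancelling common first letters.
    | j :: β => exact inner_eq_zero_symm.1 (hx' j _ (creationWord_mem hN β hy))
  | cons i α ih =>
    match β with
    | [] => exact hy' i _ (creationWord_mem hN α hx)
    | j :: β =>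
      rw [creationWord_cons, creationWord_cons]
      by_cases hij : i = j
      · subst hij
        rw [LinearIsometry.inner_map_map]
        exact ih fun hαβ => h (by rw [hαβ])
      · exact inner_creation_of_ne hij _ _

/-- An isometry `Θ` whose range is wandering is the symbol of a multi-analytic inner operator. -/
theorem exists_multiAnalyticInner [CompleteSpace Y] {D : Type u} [NormedAddCommGroup D]
    [InnerProductSpace ℂ D] [CompleteSpace D] {N : Submodule ℂ (Fock ι Y)}
    (hN : ∀ (i : ι), ∀ x ∈ N, creation i x ∈ N) (Θ : D →ₗᵢ[ℂ] Fock ι Y) (hΘ : ∀ d, Θ d ∈ N)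
    (hΘ' : ∀ d (i : ι), ∀ z ∈ N, ⟪creation i z, Θ d⟫_ℂ = 0) :
    ∃ M : Fock ι D →ₗᵢ[ℂ] Fock ι Y, (∀ d, M (vac ι D d) = Θ d) ∧
      ∀ i x, M (creation i x) = creation i (M x) := by
  classical
  have hV : OrthogonalFamily ℂ (fun _ : List ι => D) fun α => (creationWord α).comp Θ :=
    fun α β h d d' => inner_creationWord_of_ne hN (hΘ d) (hΘ d') (hΘ' d) (hΘ' d') h
  have hM : ∀ α d, hV.linearIsometry (tens α d) = creationWord α (Θ d) := fun α d =>
    hV.linearIsometry_apply_single d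
  refine ⟨hV.linearIsometry, hM [], fun i x => ?_⟩
  refine DFunLike.congr_fun (fock_ext
    (f := hV.linearIsometry.toContinuousLinearMap ∘L (creation i).toContinuousLinearMap)
    (g := (creation i).toContinuousLinearMap ∘L hV.linearIsometry.toContinuousLinearMap)
    fun α d => ?_) x
  change hV.linearIsometry (creation i (tens α d)) = creation i (hV.linearIsometry (tens α d))
  rw [creation_tens, hM, hM, creationWord_cons]

end Fock

/-! ### Defect operators and the minimal isometric dilation -/

namespace RowContraction

variable {ι : Type} {H : Type u} [NormedAddCommGroup H] [InnerProductSpace ℂ H] [CompleteSpace H]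

theorem posSqrt_comp_self {A : H →L[ℂ] H} (hA : 0 ≤ A) : posSqrt A ∘L posSqrt A = A :=
  CFC.sqrt_mul_sqrt_self A hA

theorem adjoint_posSqrt (A : H →L[ℂ] H) : (posSqrt A)† = posSqrt A :=
  (CFC.sqrt_nonneg A).isSelfAdjoint

theorem norm_row_le (T : RowContraction ι H) : ‖T.row‖ ≤ 1 := by
  rw [row, LinearIsometryEquiv.norm_map]
  exact LinearMap.mkContinuous_norm_le _ zero_le_one _

/-- The square root enters the proof only through this identity: it is self-adjoint with square `1 -
T* T`, and that operator is positive because the row has norm at most `1`. -/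
theorem inner_defectOp (T : RowContraction ι H) (f g : HSum ι H) :
    ⟪T.defectOp f, T.defectOp g⟫_ℂ = ⟪f, g⟫_ℂ - ⟪T.row f, T.row g⟫_ℂ := by
  have hpos : 0 ≤ 1 - (T.row)† ∘L T.row := by
    rw [ContinuousLinearMap.nonneg_iff_isPositive, ContinuousLinearMap.isPositive_iff']
    refine ⟨?_, fun x => ?_⟩
    · exact (IsSelfAdjoint.one _).sub
        (ContinuousLinearMap.isPositive_adjoint_comp_self _).isSelfAdjoint
    · rw [sub_apply, inner_sub_left, ContinuousLinearMap.comp_apply,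
        ContinuousLinearMap.adjoint_inner_left, one_apply_eq_self, inner_self_eq_norm_sq_to_K,
        inner_self_eq_norm_sq_to_K]
      have h1 : ‖T.row x‖ ≤ ‖x‖ := by
        simpa using T.row.le_of_opNorm_le T.norm_row_le x
      have h2 : ‖T.row x‖ ^ 2 ≤ ‖x‖ ^ 2 := by gcongr
      rw [← RCLike.ofReal_pow, ← RCLike.ofReal_pow, ← RCLike.ofReal_sub]
      exact RCLike.ofReal_nonneg.2 (sub_nonneg.2 h2)
  have hsq : T.defectOp ∘L T.defectOp = 1 - (T.row)† ∘L T.row := posSqrt_comp_self hpos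
  have hsa : (T.defectOp)† = T.defectOp := adjoint_posSqrt _
  rw [← ContinuousLinearMap.adjoint_inner_left, hsa, ← ContinuousLinearMap.comp_apply, hsq,
    sub_apply, inner_sub_left, ContinuousLinearMap.comp_apply,
    ContinuousLinearMap.adjoint_inner_left, one_apply_eq_self]

theorem norm_defectOp_sq (T : RowContraction ι H) (f : HSum ι H) :
    ‖T.defectOp f‖ ^ 2 = ‖f‖ ^ 2 - ‖T.row f‖ ^ 2 := by
  have h := T.inner_defectOp f f
  simp only [inner_self_eq_norm_sq_to_K] at h
  exact_mod_cast h

/-- The defect operator as an operator with dense range into the defect space. -/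
def defectMap (T : RowContraction ι H) : HSum ι H →L[ℂ] T.Defect :=
  T.defectOp.codRestrict T.defectSpace
    (fun _ => Submodule.le_topologicalClosure _ (LinearMap.mem_range_self _ _))

theorem coe_defectMap (T : RowContraction ι H) (f : HSum ι H) :
    (T.defectMap f : HSum ι H) = T.defectOp f := rfl

open Classical in
theorem defectMap_single (T : RowContraction ι H) (i : ι) (h : H) :
    T.defectMap (lp.single 2 i h) = T.defectComp i h := rfl

theorem denseRange_defectMap (T : RowContraction ι H) : DenseRange T.defectMap := by
  intro d
  rw [closure_subtype]
  have h : (d : HSum ι H) ∈ closure (Set.range T.defectOp) := d.2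
  convert h
  ext x
  constructor
  · rintro ⟨_, ⟨f, rfl⟩, rfl⟩
    exact ⟨f, rfl⟩
  · rintro ⟨f, rfl⟩
    exact ⟨_, ⟨f, rfl⟩, rfl⟩

open Classical in
theorem inner_defectComp (T : RowContraction ι H) (i j : ι) (h k : H) :
    ⟪T.defectComp i h, T.defectComp j k⟫_ℂ =
      (if i = j then ⟪h, k⟫_ℂ else 0) - ⟪T.op i h, T.op j k⟫_ℂ := by
  rw [Submodule.coe_inner, ← defectMap_single, ← defectMap_single, coe_defectMap, coe_defectMap,
    inner_defectOp, row_single, row_single, lp.inner_single_left]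
  congr 1
  by_cases hij : i = j
  · subst hij
    simp
  · rw [lp.single_apply_ne (E := fun _ : ι => H) 2 j k hij]
    simp [hij]

theorem mid_fst (T : RowContraction ι H) (i : ι) (x : T.MidSpace) :
    (T.mid i x).fst = T.op i x.fst := rfl

theorem mid_snd (T : RowContraction ι H) (i : ι) (x : T.MidSpace) :
    (T.mid i x).snd = vac ι T.Defect (T.defectComp i x.fst) + creation i x.snd := rfl

theorem mid_toLp_zero (T : RowContraction ι H) (i : ι) (x : Fock ι T.Defect) :
    T.mid i (WithLp.toLp 2 (0, x)) = WithLp.toLp 2 (0, creation i x) := by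
  simp [mid_apply]

-- The term `-⟪T_i h, T_j k⟫` in the inner product of defect vectors cancels the contribution of the
-- `H`-components. What remains says that the `V_i` are isometries with orthogonal ranges.
open Classical in
theorem inner_mid_mid (T : RowContraction ι H) (i j : ι) (x y : T.MidSpace) :
    ⟪T.mid i x, T.mid j y⟫_ℂ = if i = j then ⟪x, y⟫_ℂ else 0 := by
  rw [WithLp.prod_inner_apply, WithLp.prod_inner_apply]
  change ⟪(T.mid i x).fst, (T.mid j y).fst⟫_ℂ + ⟪(T.mid i x).snd, (T.mid j y).snd⟫_ℂ =
    if i = j then ⟪x.fst, y.fst⟫_ℂ + ⟪x.snd, y.snd⟫_ℂ else 0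
  rw [mid_fst, mid_fst, mid_snd, mid_snd, inner_add_left, inner_add_right, inner_add_right,
    inner_vac_vac, inner_vac_creation,
    inner_eq_zero_symm.1 (inner_vac_creation (T.defectComp j y.fst) i x.snd),
    inner_defectComp]
  by_cases hij : i = j
  · subst hij
    simp only [if_true, LinearIsometry.inner_map_map]
    ring
  · simp [hij, inner_creation_of_ne hij]

/-- The isometries of the minimal isometric dilation. -/
def midIsometry (T : RowContraction ι H) (i : ι) : T.MidSpace →ₗᵢ[ℂ] T.MidSpace :=
  LinearMap.isometryOfInner (T.mid i).toLinearMap fun x y => by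
    classical
    exact (T.inner_mid_mid i i x y).trans (if_pos rfl)

/-- Minimality of the dilation: a closed subspace that contains `H` and is invariant is everything. -/
theorem mem_of_mid_mem (T : RowContraction ι H) {S : Submodule ℂ T.MidSpace}
    (hS : IsClosed (S : Set T.MidSpace)) (hH : ∀ h : H, WithLp.toLp 2 (h, 0) ∈ S)
    (hV : ∀ i, ∀ x ∈ S, T.mid i x ∈ S) (x : T.MidSpace) : x ∈ S := by
  classical
  let J : Fock ι T.Defect →L[ℂ] T.MidSpace :=
    (WithLp.prodContinuousLinearEquiv 2 ℂ H (Fock ι T.Defect)).symm.toContinuousLinearMap ∘L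
      ContinuousLinearMap.inr ℂ H (Fock ι T.Defect)
  have hJ : ∀ y, J y = WithLp.toLp 2 (0, y) := fun y => rfl
  have hvac : ∀ d, J (vac ι T.Defect d) ∈ S := by
    intro d
    refine T.denseRange_defectMap.induction_on (p := fun d => J (vac ι T.Defect d) ∈ S) d ?_ ?_
    · exact hS.preimage (J ∘L vac ι T.Defect).continuous
    · intro f
      refine mem_of_forall_single_mem
        (S := S.comap (J ∘L vac ι T.Defect ∘L T.defectMap).toLinearMap)
        (hS.preimage (J ∘L vac ι T.Defect ∘L T.defectMap).continuous) (fun i h => ?_) f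
      -- The vacuum layer is reached from `H` by `e_0 ⊗ D_i h = V_i h - T_i h`. The higher layers
      -- follow because `V_i` acts on `0 ⊕ (Γ ⊗ 𝒟)` as `L_i ⊗ 1`.
      have h1 : J (vac ι T.Defect (T.defectMap (lp.single 2 i h))) =
          T.mid i (WithLp.toLp 2 (h, 0)) - WithLp.toLp 2 (T.op i h, 0) := by
        rw [hJ, mid_apply, defectMap_single, ← WithLp.toLp_sub]
        simp
      change J (vac ι T.Defect (T.defectMap (lp.single 2 i h))) ∈ S
      rw [h1]
      exact S.sub_mem (hV i _ (hH h)) (hH _)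
  have hfock : ∀ y, J y ∈ S := by
    refine mem_of_forall_tens_mem (S := S.comap J.toLinearMap) (hS.preimage J.continuous)
      fun α d => ?_
    change J (tens α d) ∈ S
    induction α with
    | nil => exact hvac d
    | cons i α ih =>
      rw [← creation_tens, hJ, ← mid_toLp_zero]
      exact hV i _ ih
  have hx : x = WithLp.toLp 2 (x.fst, 0) + J x.snd := by
    rw [hJ, ← WithLp.toLp_add, Prod.mk_add_mk, add_zero, zero_add]
    rfl
  rw [hx]
  exact S.add_mem (hH _) (hfock _)

end RowContraction

/-! ### The lifting constructed from an invariant subspace -/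

section Model

variable {ι : Type} {H : Type u} [NormedAddCommGroup H] [InnerProductSpace ℂ H] [CompleteSpace H]
  (C : RowContraction ι H)

/-- A tuple of operators that is contractive on finite rows satisfies `∑ i, T i * (T i)† ≤ 1`. -/
theorem sum_comp_adjoint_le_one {T : ι → H →L[ℂ] H}
    (hT : ∀ (s : Finset ι) (g : ι → H), ‖∑ i ∈ s, T i (g i)‖ ^ 2 ≤ ∑ i ∈ s, ‖g i‖ ^ 2)
    (s : Finset ι) : ∑ i ∈ s, T i ∘L (T i)† ≤ 1 := by
  have hsum : ∀ k, ⟪(∑ i ∈ s, T i ∘L (T i)†) k, k⟫_ℂ = ((∑ i ∈ s, ‖((T i)†) k‖ ^ 2 : ℝ) : ℂ) := by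
    intro k
    rw [sum_apply, sum_inner, Complex.ofReal_sum]
    refine Finset.sum_congr rfl fun i _ => ?_
    rw [ContinuousLinearMap.comp_apply, ← ContinuousLinearMap.adjoint_inner_right,
      inner_self_eq_norm_sq_to_K]
    simp
  rw [ContinuousLinearMap.le_def, ContinuousLinearMap.isPositive_iff']
  refine ⟨(IsSelfAdjoint.one _).sub (isSelfAdjoint_sum _ fun i _ => ?_), fun k => ?_⟩
  · exact (ContinuousLinearMap.isPositive_self_comp_adjoint (T i)).isSelfAdjoint
  · have h1 := hT s fun i => ((T i)†) k
    have h2 : ∑ i ∈ s, ‖((T i)†) k‖ ^ 2 ≤ ‖∑ i ∈ s, T i (((T i)†) k)‖ * ‖k‖ := by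
      have h := norm_inner_le_norm (𝕜 := ℂ) ((∑ i ∈ s, T i ∘L (T i)†) k) k
      rw [hsum, Complex.norm_real, sum_apply] at h
      exact (le_abs_self _).trans h
    have h3 : ∑ i ∈ s, ‖((T i)†) k‖ ^ 2 ≤ ‖k‖ ^ 2 := by
      nlinarith [sq_nonneg (‖∑ i ∈ s, T i (((T i)†) k)‖ - ‖k‖)]
    rw [sub_apply, inner_sub_left, hsum, one_apply_eq_self, inner_self_eq_norm_sq_to_K,
      ← RCLike.ofReal_pow]
    erw [← RCLike.ofReal_sub]
    exact RCLike.ofReal_nonneg.2 (sub_nonneg.2 h3)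

variable {C} in
/-- An isometric copy of the space of a lifting in the dilation space of `C` extends to an
intertwiner if the dilation of `C` decomposes along it with a wandering isometry on the defect
space. -/
theorem Lifting.exists_intertwiner_of_symbol (E : Lifting C) {N : Submodule ℂ (Fock ι C.Defect)}
    (hN : IsClosed (N : Set (Fock ι C.Defect))) (hI : ∀ (i : ι), ∀ x ∈ N, creation i x ∈ N)
    (j : E.Space →ₗᵢ[ℂ] C.MidSpace) (hj : ∀ h, j (E.emb h) = WithLp.toLp 2 (h, 0))
    (hjN : ∀ k, (j k).snd ∈ Nᗮ) (Θ : E.row.Defect →ₗᵢ[ℂ] Fock ι C.Defect) (hΘ : ∀ d, Θ d ∈ N)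
    (hΘ' : ∀ d (i : ι), ∀ z ∈ N, ⟪creation i z, Θ d⟫_ℂ = 0)
    (hmid : ∀ i k, C.mid i (j k) =
      j (E.row.op i k) + WithLp.toLp 2 (0, Θ (E.row.defectComp i k))) :
    ∃ w : Intertwiner E, ∀ k, w.W (WithLp.toLp 2 (k, 0)) = j k := by
  obtain ⟨M, hM, hMc⟩ := exists_multiAnalyticInner hI Θ hΘ hΘ'
  have hMN : ∀ x, M x ∈ N := by
    refine mem_of_forall_tens_mem (S := N.comap M.toLinearMap) (hN.preimage M.continuous)
      fun α d => ?_
    change M (tens α d) ∈ N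
    induction α with
    | nil => rw [← vac_apply, hM]; exact hΘ d
    | cons i α ih => rw [← creation_tens, hMc]; exact hI i _ ih
  let L : E.row.MidSpace →ₗ[ℂ] C.MidSpace :=
    j.toLinearMap ∘ₗ (WithLp.fstL 2 ℂ E.Space (Fock ι E.row.Defect)).toLinearMap +
      (WithLp.linearEquiv 2 ℂ (H × Fock ι C.Defect)).symm.toLinearMap ∘ₗ
        LinearMap.inr ℂ H (Fock ι C.Defect) ∘ₗ M.toLinearMap ∘ₗ
          (WithLp.sndL 2 ℂ E.Space (Fock ι E.row.Defect)).toLinearMap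
  have hL : ∀ x, L x = j x.fst + WithLp.toLp 2 (0, M x.snd) := fun x => rfl
  have hperp : ∀ k x, ⟪j k, (WithLp.toLp 2 (0, M x) : C.MidSpace)⟫_ℂ = 0 := fun k x => by
    rw [WithLp.prod_inner_apply]
    have := inner_eq_zero_symm.1 (hjN k _ (hMN x))
    simpa using this
  let J : E.row.MidSpace →ₗᵢ[ℂ] C.MidSpace := L.isometryOfInner fun x y => by
    rw [hL, hL, inner_add_left, inner_add_right, inner_add_right, hperp,
      inner_eq_zero_symm.1 (hperp y.fst x.snd), j.inner_map_map, WithLp.prod_inner_apply,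
      WithLp.prod_inner_apply]
    simp
  have hJ : ∀ x, J x = j x.fst + WithLp.toLp 2 (0, M x.snd) := hL
  have hadd : ∀ a b : Fock ι C.Defect, (WithLp.toLp 2 (0, a + b) : C.MidSpace) =
      WithLp.toLp 2 (0, a) + WithLp.toLp 2 (0, b) := fun a b => by
    rw [← WithLp.toLp_add, Prod.mk_add_mk, add_zero]
  have hcomm : ∀ i x, J (E.row.mid i x) = C.mid i (J x) := fun i x => by
    rw [hJ, hJ, map_add, RowContraction.mid_fst, RowContraction.mid_snd, C.mid_toLp_zero, map_add,
      hM, hMc, hmid, add_assoc, hadd]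
  have hemb : ∀ h, J (WithLp.toLp 2 (E.emb h, 0)) = WithLp.toLp 2 (h, 0) := fun h => by
    rw [hJ, WithLp.toLp_fst, WithLp.toLp_snd, map_zero, hj, ← WithLp.toLp_add]
    simp
  -- The range of an isometry on a complete space is closed. This one contains `H` and is invariant
  -- under the dilation, so it is everything by minimality.
  have hsurj : Function.Surjective J := fun y =>
    C.mem_of_mid_mem (S := LinearMap.range J.toLinearMap)
      J.isometry.isClosedEmbedding.isClosed_range
      (fun h => ⟨_, hemb h⟩) (fun i _ ⟨x, hx⟩ => ⟨_, (hcomm i x).trans (congrArg _ hx)⟩) y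
  refine ⟨⟨LinearIsometryEquiv.ofSurjective J hsurj, hemb, hcomm⟩, fun k => (hJ _).trans ?_⟩
  rw [WithLp.toLp_fst, WithLp.toLp_snd, map_zero]
  exact add_zero _

/-! ### The compression to the model space and its defect -/

variable (N : Submodule ℂ (Fock ι C.Defect))

theorem mem_modelSpace {x : C.MidSpace} : x ∈ modelSpace C N ↔ x.snd ∈ Nᗮ := Iff.rfl

theorem toLp_zero_mem_modelSpace (h : H) : WithLp.toLp 2 (h, 0) ∈ modelSpace C N :=
  Nᗮ.zero_mem

variable {C N} in
theorem fst_eq_zero_of_mem_modelSpace_orthogonal {x : C.MidSpace} (hx : x ∈ (modelSpace C N)ᗮ) :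
    x.fst = 0 := by
  have h := hx _ (toLp_zero_mem_modelSpace C N x.fst)
  rw [WithLp.prod_inner_apply] at h
  simpa using h

-- The complement of the model space is `0 ⊕ Nᗮᗮ`; closedness of `N` is what turns this into `0 ⊕
-- N`.
variable {C N} in
theorem snd_mem_of_mem_modelSpace_orthogonal (hN : IsClosed (N : Set (Fock ι C.Defect)))
    {x : C.MidSpace} (hx : x ∈ (modelSpace C N)ᗮ) : x.snd ∈ N := by
  have h : x.snd ∈ Nᗮᗮ := fun z hz => by
    have h := hx (WithLp.toLp 2 (0, z)) hz
    rw [WithLp.prod_inner_apply] at h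
    simpa using h
  rwa [Submodule.orthogonal_orthogonal_eq_closure, hN.submodule_topologicalClosure_eq] at h

theorem orthogonalFamily_modelSpace : OrthogonalFamily ℂ (fun _ : ι => modelSpace C N)
    fun i => (C.midIsometry i).comp (modelSpace C N).subtypeₗᵢ := fun i j hij x y => by
  classical
  exact (C.inner_mid_mid i j x y).trans (if_neg hij)

/-- The compression of the minimal isometric dilation to the model space. -/
def modelRow : RowContraction ι (modelSpace C N) where
  op i := (modelSpace C N).orthogonalProjectionOnto ∘L C.mid i ∘L (modelSpace C N).subtypeL
  sum_le_one := by
    refine sum_comp_adjoint_le_one fun s g => ?_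
    -- The sum `∑ V_i g_i` has orthogonal terms of norm `‖g_i‖`, and the compressed row is its image
    -- under a contractive projection.
    rw [← (orthogonalFamily_modelSpace C N).norm_sum g s]
    have h : ∑ i ∈ s, ((modelSpace C N).orthogonalProjectionOnto ∘L C.mid i ∘L
        (modelSpace C N).subtypeL) (g i) = (modelSpace C N).orthogonalProjectionOnto
        (∑ i ∈ s, ((C.midIsometry i).comp (modelSpace C N).subtypeₗᵢ) (g i)) := by
      rw [map_sum]
      rfl
    rw [h]
    gcongr
    exact Submodule.norm_orthogonalProjectionOnto_apply_le _ _

theorem modelRow_op (i : ι) (k : modelSpace C N) :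
    (modelRow C N).op i k = (modelSpace C N).orthogonalProjectionOnto (C.mid i k) := rfl

/-- The isometric row `(k_i)_i ↦ ∑ i, V i k_i` on the direct sum of copies of the model space. -/
def modelIsometry : HSum ι (modelSpace C N) →ₗᵢ[ℂ] C.MidSpace :=
  (orthogonalFamily_modelSpace C N).linearIsometry

open Classical in
theorem modelIsometry_single (i : ι) (k : modelSpace C N) :
    modelIsometry C N (lp.single 2 i k) = C.mid i k :=
  (orthogonalFamily_modelSpace C N).linearIsometry_apply_single k

theorem modelRow_row (f : HSum ι (modelSpace C N)) :
    (modelRow C N).row f = (modelSpace C N).orthogonalProjectionOnto (modelIsometry C N f) := by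
  classical
  let g := (modelSpace C N).orthogonalProjectionOnto ∘L (modelIsometry C N).toContinuousLinearMap
  refine mem_of_forall_single_mem (S := LinearMap.eqLocus (modelRow C N).row.toLinearMap
    g.toLinearMap) (isClosed_eq (modelRow C N).row.continuous g.continuous) (fun i k => ?_) f
  change (modelRow C N).row (lp.single 2 i k) =
    (modelSpace C N).orthogonalProjectionOnto (modelIsometry C N (lp.single 2 i k))
  rw [RowContraction.row_single, modelIsometry_single, modelRow_op]

/-- The isometric row followed by the projection onto the orthogonal complement of the model
space. -/
def modelResidual : HSum ι (modelSpace C N) →L[ℂ] C.MidSpace :=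
  (modelIsometry C N).toContinuousLinearMap -
    (modelSpace C N).subtypeL ∘L (modelSpace C N).orthogonalProjectionOnto ∘L
      (modelIsometry C N).toContinuousLinearMap

theorem modelResidual_apply (f : HSum ι (modelSpace C N)) :
    modelResidual C N f = modelIsometry C N f -
      ((modelSpace C N).orthogonalProjectionOnto (modelIsometry C N f) : C.MidSpace) := rfl

open Classical in
theorem mid_eq_modelRow_add (i : ι) (k : modelSpace C N) :
    C.mid i k = ((modelRow C N).op i k : C.MidSpace) + modelResidual C N (lp.single 2 i k) := by
  rw [modelResidual_apply, modelIsometry_single, modelRow_op, add_sub_cancel]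

theorem modelResidual_mem (f : HSum ι (modelSpace C N)) :
    modelResidual C N f ∈ (modelSpace C N)ᗮ :=
  Submodule.sub_starProjection_mem_orthogonal _

theorem modelResidual_eq (f : HSum ι (modelSpace C N)) :
    modelResidual C N f = WithLp.toLp 2 (0, (modelResidual C N f).snd) := by
  rw [← fst_eq_zero_of_mem_modelSpace_orthogonal (modelResidual_mem C N f)]
  rfl

/-- The isometric row splits `‖f‖²` into the squared norms of the compressed row and of the
residual, so the latter is `‖f‖² - ‖E f‖² = ‖D f‖²`. This makes `D f ↦` residual well defined and
isometric. -/
theorem norm_modelResidual_snd (f : HSum ι (modelSpace C N)) :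
    ‖(modelResidual C N f).snd‖ = ‖(modelRow C N).defectMap f‖ := by
  have h1 : ‖(modelResidual C N f).snd‖ = ‖modelResidual C N f‖ := by
    rw [modelResidual_eq]
    simp
  have h2 := Submodule.norm_sq_eq_add_norm_sq_projection (modelIsometry C N f) (modelSpace C N)
  have h3 : ((modelSpace C N)ᗮ.orthogonalProjectionOnto (modelIsometry C N f) : C.MidSpace) =
      modelResidual C N f := Submodule.starProjection_orthogonal_val _
  rw [← Submodule.norm_coe (s := (modelSpace C N)ᗮ), h3, ← modelRow_row,
    LinearIsometry.norm_map] at h2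
  have h4 := (modelRow C N).norm_defectOp_sq f
  rw [h1, ← Submodule.norm_coe, RowContraction.coe_defectMap,
    ← sq_eq_sq₀ (norm_nonneg _) (norm_nonneg _)]
  linarith

/-- On a single summand the residual is `V_j k - E_j k`. The vector `0 ⊕ (L_i ⊗ 1) z = V_i (0 ⊕ z)`
is orthogonal to `V_j k`, since either `i ≠ j` or `z ⊥ k`. It is orthogonal to `E_j k` because `(L_i
⊗ 1) z` stays in `N`. -/
theorem inner_creation_modelResidual_snd (hI : ∀ (i : ι), ∀ x ∈ N, creation i x ∈ N) (i : ι)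
    {z : Fock ι C.Defect} (hz : z ∈ N) (f : HSum ι (modelSpace C N)) :
    ⟪creation i z, (modelResidual C N f).snd⟫_ℂ = 0 := by
  classical
  have h0 : ∀ x : C.MidSpace, ⟪(WithLp.toLp 2 (0, creation i z) : C.MidSpace), x⟫_ℂ =
      ⟪creation i z, x.snd⟫_ℂ := fun x => by
    rw [WithLp.prod_inner_apply]
    simp
  rw [← h0]
  have key : innerSL ℂ (WithLp.toLp 2 (0, creation i z) : C.MidSpace) ∘L modelResidual C N = 0 := by
    refine lp.ext_continuousLinearMap (by simp) fun j => ?_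
    ext k
    change ⟪(WithLp.toLp 2 (0, creation i z) : C.MidSpace),
      modelResidual C N (lp.single 2 j k)⟫_ℂ = 0
    have h1 : ⟪C.mid i (WithLp.toLp 2 (0, z)), C.mid j k⟫_ℂ = 0 := by
      rw [C.inner_mid_mid]
      split_ifs
      · rw [WithLp.prod_inner_apply]
        have := (mem_modelSpace C N).1 k.2 z hz
        simpa using this
      · rfl
    have h2 : ⟪(WithLp.toLp 2 (0, creation i z) : C.MidSpace),
        ((modelRow C N).op j k : C.MidSpace)⟫_ℂ = 0 := by
      rw [h0]
      exact (mem_modelSpace C N).1 ((modelRow C N).op j k).2 _ (hI i z hz)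
    rwa [mid_eq_modelRow_add, inner_add_right, C.mid_toLp_zero, h2, zero_add] at h1
  exact DFunLike.congr_fun key f

/-- The symbol of the characteristic function of the model lifting. -/
theorem exists_model_symbol (hN : IsClosed (N : Set (Fock ι C.Defect)))
    (hI : ∀ (i : ι), ∀ x ∈ N, creation i x ∈ N) :
    ∃ Θ : (modelRow C N).Defect →ₗᵢ[ℂ] Fock ι C.Defect,
      (∀ f, Θ ((modelRow C N).defectMap f) = (modelResidual C N f).snd) ∧ (∀ d, Θ d ∈ N) ∧
      ∀ d (i : ι), ∀ z ∈ N, ⟪creation i z, Θ d⟫_ℂ = 0 := by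
  classical
  let r : HSum ι (modelSpace C N) →L[ℂ] Fock ι C.Defect :=
    WithLp.sndL 2 ℂ H (Fock ι C.Defect) ∘L modelResidual C N
  have hr : ∀ f, r f = (modelResidual C N f).snd := fun f => rfl
  have hdense := (modelRow C N).denseRange_defectMap
  obtain ⟨Θ, hΘ⟩ : ∃ Θ : (modelRow C N).Defect →L[ℂ] Fock ι C.Defect,
      ∀ f, Θ ((modelRow C N).defectMap f) = (modelResidual C N f).snd :=
    ⟨r.toLinearMap.extendOfNorm (modelRow C N).defectMap.toLinearMap, fun f =>
      LinearMap.extendOfNorm_eq (e := (modelRow C N).defectMap.toLinearMap) hdense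
        ⟨1, fun x => by rw [one_mul]; exact (norm_modelResidual_snd C N x).le⟩ f⟩
  have hnorm : ∀ d, ‖Θ d‖ = ‖d‖ := fun d =>
    hdense.induction_on d (isClosed_eq (by fun_prop) (by fun_prop)) fun f => by
      rw [hΘ, norm_modelResidual_snd]
  refine ⟨⟨Θ.toLinearMap, hnorm⟩, hΘ, fun d => ?_, fun d i z hz => ?_⟩
  · change Θ d ∈ N
    refine hdense.induction_on (p := fun d => Θ d ∈ N) d (hN.preimage Θ.continuous) fun f => ?_
    rw [hΘ]
    exact snd_mem_of_mem_modelSpace_orthogonal hN (modelResidual_mem C N f)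
  · change ⟪creation i z, Θ d⟫_ℂ = 0
    refine hdense.induction_on (p := fun d => ⟪creation i z, Θ d⟫_ℂ = 0) d
      (isClosed_eq (by fun_prop) (by fun_prop)) fun f => ?_
    rw [hΘ]
    exact inner_creation_modelResidual_snd C N hI i hz f

/-- The residual has no `H`-component, so compressing leaves the `H`-component of `V_i k` unchanged.
This is the lifting property of the model. -/
theorem modelRow_op_fst (i : ι) (k : modelSpace C N) :
    ((modelRow C N).op i k : C.MidSpace).fst = C.op i (k : C.MidSpace).fst := by
  classical
  have h := congrArg WithLp.fst (mid_eq_modelRow_add C N i k)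
  rw [WithLp.add_fst, fst_eq_zero_of_mem_modelSpace_orthogonal (modelResidual_mem C N _),
    add_zero] at h
  exact h.symm

/-- The embedding of `H` into the model space. -/
def modelEmb : H →ₗᵢ[ℂ] modelSpace C N where
  toFun h := ⟨WithLp.toLp 2 (h, 0), toLp_zero_mem_modelSpace C N h⟩
  map_add' x y := by
    ext1
    change WithLp.toLp 2 (x + y, 0) = WithLp.toLp 2 (x, 0) + WithLp.toLp 2 (y, 0)
    rw [← WithLp.toLp_add, Prod.mk_add_mk, add_zero]
  map_smul' c x := by
    ext1
    change WithLp.toLp 2 (c • x, 0) = c • WithLp.toLp 2 (x, 0)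
    rw [← WithLp.toLp_smul, Prod.smul_mk, smul_zero]
  norm_map' x := by
    change ‖(WithLp.toLp 2 (x, 0) : C.MidSpace)‖ = ‖x‖
    simp

theorem adjoint_modelEmb (k : modelSpace C N) :
    ContinuousLinearMap.adjoint (𝕜 := ℂ) (E := H) (F := modelSpace C N)
      (modelEmb C N).toContinuousLinearMap k = (k : C.MidSpace).fst := by
  refine ext_inner_left ℂ fun h => ?_
  rw [ContinuousLinearMap.adjoint_inner_right]
  change ⟪(WithLp.toLp 2 (h, 0) : C.MidSpace), (k : C.MidSpace)⟫_ℂ = _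
  rw [WithLp.prod_inner_apply]
  simp

/-- The lifting on the model space. -/
def modelLifting : Lifting C where
  Space := modelSpace C N
  row := modelRow C N
  emb := modelEmb C N
  proj_comp i := by
    ext k
    rw [ContinuousLinearMap.comp_apply, ContinuousLinearMap.comp_apply, adjoint_modelEmb,
      adjoint_modelEmb, modelRow_op_fst]

theorem modelLifting_hasModel : (modelLifting C N).HasModel N :=
  ⟨LinearIsometryEquiv.refl ℂ (modelSpace C N), fun _ => rfl, fun _ _ => rfl⟩

/-- The model lifting is subisometric, with a unitary that extends the inclusion of the model
space. -/
theorem exists_lifting_hasModel (hN : IsClosed (N : Set (Fock ι C.Defect)))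
    (hI : ∀ (i : ι), ∀ x ∈ N, creation i x ∈ N) :
    ∃ (E : Lifting C) (w : Intertwiner E), E.HasModel N ∧ ∀ x : C.MidSpace,
      x ∈ modelSpace C N ↔ ∃ k, w.W (WithLp.toLp 2 (k, 0)) = x := by
  classical
  obtain ⟨Θ, hΘ, hΘN, hΘw⟩ := exists_model_symbol C N hN hI
  obtain ⟨w, hw⟩ := (modelLifting C N).exists_intertwiner_of_symbol hN hI
    (modelSpace C N).subtypeₗᵢ (fun _ => rfl) (fun k => k.2) Θ hΘN hΘw fun i k => by
      refine (mid_eq_modelRow_add C N i k).trans ?_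
      rw [modelResidual_eq, ← hΘ]
      rfl
  refine ⟨modelLifting C N, w, modelLifting_hasModel C N, fun x => ⟨fun hx => ⟨⟨x, hx⟩, hw _⟩, ?_⟩⟩
  rintro ⟨k, rfl⟩
  rw [hw]
  exact k.2

end Model

/-! ### Uniqueness -/

section Uniqueness

variable {ι : Type} {H : Type u} [NormedAddCommGroup H] [InnerProductSpace ℂ H] [CompleteSpace H]
  {C : RowContraction ι H}

/-- The restriction of `W` to the space of the lifting. -/
def Intertwiner.spaceIsometry {E : Lifting C} (w : Intertwiner E) : E.Space →ₗᵢ[ℂ] C.MidSpace where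
  toFun a := w.W (WithLp.toLp 2 (a, 0))
  map_add' a b := by
    rw [← map_add, ← WithLp.toLp_add, Prod.mk_add_mk, add_zero]
  map_smul' c a := by
    rw [RingHom.id_apply, ← map_smul, ← WithLp.toLp_smul, Prod.smul_mk, smul_zero]
  norm_map' a := by
    change ‖w.W (WithLp.toLp 2 (a, 0))‖ = ‖a‖
    rw [w.W.norm_map]
    simp

namespace Intertwiner

variable {E E' : Lifting C} (w : Intertwiner E) (w' : Intertwiner E')

theorem spaceIsometry_apply (a : E.Space) : w.spaceIsometry a = w.W (WithLp.toLp 2 (a, 0)) := rfl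

theorem spaceIsometry_emb (h : H) : w.spaceIsometry (E.emb h) = WithLp.toLp 2 (h, 0) :=
  w.map_emb h

theorem onSpace_emb (h : H) : w.onSpace (E.emb h) = 0 :=
  congrArg WithLp.snd (w.map_emb h)

theorem mem_complement {a : E.Space} : a ∈ E.complement ↔ ∀ h, ⟪E.emb h, a⟫_ℂ = 0 := by
  rw [Lifting.complement, Submodule.mem_orthogonal]
  exact ⟨fun h x => h _ ⟨x, rfl⟩, fun h _ ⟨x, hx⟩ => hx ▸ h x⟩

theorem mem_invariantSubspace {y : Fock ι C.Defect} :
    y ∈ w.invariantSubspace ↔ ∀ a ∈ E.complement, ⟪w.onSpace a, y⟫_ℂ = 0 := by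
  rw [invariantSubspace, Submodule.mem_orthogonal]
  exact ⟨fun h a ha => h _ ⟨a, ha, rfl⟩, fun h _ ⟨a, ha, hx⟩ => hx ▸ h a ha⟩

theorem exists_eq_emb_add (a : E.Space) : ∃ h, ∃ b ∈ E.complement, a = E.emb h + b := by
  refine ⟨ContinuousLinearMap.adjoint E.emb.toContinuousLinearMap a,
    a - E.emb (ContinuousLinearMap.adjoint E.emb.toContinuousLinearMap a),
    mem_complement.2 fun h => ?_, (add_sub_cancel _ _).symm⟩
  rw [inner_sub_right, LinearIsometry.inner_map_map, ContinuousLinearMap.adjoint_inner_right]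
  exact sub_self _

theorem inner_zero_left_eq (z : Fock ι C.Defect) (x : C.MidSpace) :
    ⟪x, (WithLp.toLp 2 (0, z) : C.MidSpace)⟫_ℂ = ⟪x.snd, z⟫_ℂ := by
  rw [WithLp.prod_inner_apply]
  simp

/-- Since `onSpace` vanishes on `H`, being orthogonal to the image of `H_A` already means being
orthogonal to the image of all of `H_E`. -/
theorem inner_onSpace_of_mem {y : Fock ι C.Defect} (hy : y ∈ w.invariantSubspace) (a : E.Space) :
    ⟪w.onSpace a, y⟫_ℂ = 0 := by
  obtain ⟨h, b, hb, rfl⟩ := exists_eq_emb_add a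
  rw [map_add, onSpace_emb, zero_add]
  exact w.mem_invariantSubspace.1 hy b hb

theorem inner_spaceIsometry_W (a : E.Space) (x : Fock ι E.row.Defect) :
    ⟪w.spaceIsometry a, w.W (WithLp.toLp 2 (0, x))⟫_ℂ = 0 := by
  rw [spaceIsometry_apply, LinearIsometryEquiv.inner_map_map, WithLp.prod_inner_apply]
  simp

/-- The range of the characteristic function is the invariant subspace of the lifting. -/
theorem range_charFun : LinearMap.range w.charFun.M.toLinearMap = w.invariantSubspace := by
  ext y
  constructor
  · rintro ⟨x, rfl⟩
    refine w.mem_invariantSubspace.2 fun a _ => ?_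
    have h := w.inner_spaceIsometry_W a x
    rwa [w.W_fock x, inner_zero_left_eq] at h
  · intro hy
    obtain ⟨z, hz⟩ := w.W.surjective (WithLp.toLp 2 (0, y))
    have h0 : z.fst = 0 := by
      refine ext_inner_left ℂ fun b => ?_
      have h1 : ⟪w.W (WithLp.toLp 2 (b, 0)), w.W z⟫_ℂ = ⟪b, z.fst⟫_ℂ := by
        rw [LinearIsometryEquiv.inner_map_map, WithLp.prod_inner_apply]
        simp
      rw [inner_zero_right, ← h1, hz, inner_zero_left_eq]
      exact w.inner_onSpace_of_mem hy b
    have h1 : z = WithLp.toLp 2 (0, z.snd) := by rw [← h0]; rfl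
    exact ⟨z.snd, congrArg WithLp.snd ((congrArg w.W h1).symm.trans hz)⟩

theorem range_spaceIsometry :
    LinearMap.range w.spaceIsometry.toLinearMap = modelSpace C w.invariantSubspace := by
  ext x
  rw [mem_modelSpace]
  constructor
  · rintro ⟨a, rfl⟩ y hy
    exact inner_eq_zero_symm.1 (w.inner_onSpace_of_mem hy a)
  · intro hx
    obtain ⟨z, rfl⟩ := w.W.surjective x
    have h0 : z.snd = 0 := by
      have h1 : w.charFun.M z.snd ∈ w.invariantSubspace := w.range_charFun ▸ ⟨z.snd, rfl⟩
      have h2 := hx _ h1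
      have h3 : ⟪w.W z, w.W (WithLp.toLp 2 (0, z.snd))⟫_ℂ = ⟪z.snd, z.snd⟫_ℂ := by
        rw [LinearIsometryEquiv.inner_map_map, WithLp.prod_inner_apply]
        simp
      rw [w.W_fock, inner_zero_left_eq] at h3
      rw [← inner_self_eq_zero (𝕜 := ℂ), ← h3]
      exact inner_eq_zero_symm.1 h2
    exact ⟨z.fst, by
      rw [LinearIsometry.coe_toLinearMap, spaceIsometry_apply, ← h0]
      rfl⟩

/-- A subisometric lifting is unitarily equivalent to its model. -/
theorem hasModel : E.HasModel w.invariantSubspace := by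
  have hmem : ∀ a, w.spaceIsometry a ∈ modelSpace C w.invariantSubspace := fun a =>
    w.range_spaceIsometry ▸ ⟨a, rfl⟩
  let j : E.Space →ₗᵢ[ℂ] modelSpace C w.invariantSubspace :=
    ⟨w.spaceIsometry.toLinearMap.codRestrict _ hmem, w.spaceIsometry.norm_map⟩
  have hj : ∀ a, (j a : C.MidSpace) = w.spaceIsometry a := fun a => rfl
  have hsurj : Function.Surjective j := fun x => by
    obtain ⟨a, ha⟩ := w.range_spaceIsometry.ge x.2
    exact ⟨a, Subtype.ext ha⟩
  refine ⟨LinearIsometryEquiv.ofSurjective j hsurj, w.spaceIsometry_emb, fun i a => ?_⟩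
  -- Applying `W` to `V_i^E a = E_i a + e_0 ⊗ D_i a` splits `V_i^C W a` into a part in the model
  -- space and a part orthogonal to it.
  have h1 : C.mid i (w.spaceIsometry a) = (j (E.row.op i a) : C.MidSpace) +
      w.W (WithLp.toLp 2 (0, vac ι E.row.Defect (E.row.defectComp i a))) := by
    rw [hj, spaceIsometry_apply, spaceIsometry_apply, ← w.comm, RowContraction.mid_apply, ← map_add,
      ← WithLp.toLp_add]
    simp
  have h2 : w.W (WithLp.toLp 2 (0, vac ι E.row.Defect (E.row.defectComp i a))) ∈
      (modelSpace C w.invariantSubspace)ᗮ := by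
    rw [← w.range_spaceIsometry]
    rintro _ ⟨b, rfl⟩
    exact w.inner_spaceIsometry_W b _
  change j (E.row.op i a) =
    (modelSpace C w.invariantSubspace).orthogonalProjectionOnto (C.mid i (w.spaceIsometry a))
  rw [h1, map_add, Submodule.orthogonalProjectionOnto_mem_subspace_eq_self,
    Submodule.orthogonalProjectionOnto_apply_of_mem_orthogonal h2, add_zero]

-- Both sides are bounded in `y`, agree on `H` and intertwine `V_i^C` with `E'_i`, so minimality
-- applies. The argument uses `P_{H_E} W⁻¹` because it intertwines `V_i^C` with `E_i`, whereas `W`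
-- restricted to `H_E` in general does not.
variable {w w'} in
theorem fst_symm_eq {u : E.Space ≃ₗᵢ[ℂ] E'.Space} (hu : ∀ h, u (E.emb h) = E'.emb h)
    (hc : ∀ i x, u (E.row.op i x) = E'.row.op i (u x)) (y : C.MidSpace) :
    u (w.W.symm y).fst = (w'.W.symm y).fst := by
  have hV : ∀ (E : Lifting C) (w : Intertwiner E) i x,
      w.W.symm (C.mid i x) = E.row.mid i (w.W.symm x) := fun E w i x => by
    rw [LinearIsometryEquiv.symm_apply_eq, w.comm, LinearIsometryEquiv.apply_symm_apply]
  let f : C.MidSpace →L[ℂ] E'.Space := u.toLinearIsometry.toContinuousLinearMap ∘L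
    WithLp.fstL 2 ℂ E.Space (Fock ι E.row.Defect) ∘L
      w.W.symm.toLinearIsometry.toContinuousLinearMap
  let g : C.MidSpace →L[ℂ] E'.Space := WithLp.fstL 2 ℂ E'.Space (Fock ι E'.row.Defect) ∘L
    w'.W.symm.toLinearIsometry.toContinuousLinearMap
  refine C.mem_of_mid_mem (S := LinearMap.eqLocus f.toLinearMap g.toLinearMap)
    (isClosed_eq f.continuous g.continuous) (fun h => ?_) (fun i x hx => ?_) y
  · change u (w.W.symm (WithLp.toLp 2 (h, 0))).fst = (w'.W.symm (WithLp.toLp 2 (h, 0))).fst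
    rw [← w.map_emb, LinearIsometryEquiv.symm_apply_apply, w.map_emb, ← w'.map_emb,
      LinearIsometryEquiv.symm_apply_apply]
    exact hu h
  · change u (w.W.symm (C.mid i x)).fst = (w'.W.symm (C.mid i x)).fst
    replace hx : u (w.W.symm x).fst = (w'.W.symm x).fst := hx
    rw [hV, hV, RowContraction.mid_fst, RowContraction.mid_fst, hc, hx]

/-- The adjoint of `w.spaceIsometry` is `y ↦ (w.W.symm y).fst`, so this is the adjoint form of
`fst_symm_eq`. -/
theorem spaceIsometry_eq {u : E.Space ≃ₗᵢ[ℂ] E'.Space} (hu : ∀ h, u (E.emb h) = E'.emb h)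
    (hc : ∀ i x, u (E.row.op i x) = E'.row.op i (u x)) (a : E.Space) :
    w'.spaceIsometry (u a) = w.spaceIsometry a := by
  have key : ∀ (E : Lifting C) (w : Intertwiner E) a y,
      ⟪w.spaceIsometry a, y⟫_ℂ = ⟪a, (w.W.symm y).fst⟫_ℂ := fun E w a y => by
    rw [spaceIsometry_apply, ← LinearIsometryEquiv.inner_map_map w.W.symm,
      LinearIsometryEquiv.symm_apply_apply, WithLp.prod_inner_apply]
    simp
  refine ext_inner_right ℂ fun y => ?_
  rw [key, key, ← fst_symm_eq (w := w) hu hc, LinearIsometryEquiv.inner_map_map]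

theorem invariantSubspace_le (h : E.UnitarilyEquivalent E') :
    w'.invariantSubspace ≤ w.invariantSubspace := by
  obtain ⟨u, hu, hc⟩ := h
  intro y hy
  refine w.mem_invariantSubspace.2 fun a _ => ?_
  have h1 : w.onSpace a = w'.onSpace (u a) :=
    (congrArg WithLp.snd (w.spaceIsometry_eq w' hu hc a)).symm
  rw [h1]
  exact w'.inner_onSpace_of_mem hy _

end Intertwiner

theorem Lifting.HasModel.unitarilyEquivalent {E E' : Lifting C} {N : Submodule ℂ (Fock ι C.Defect)}
    (h : E.HasModel N) (h' : E'.HasModel N) : E.UnitarilyEquivalent E' := by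
  obtain ⟨u, hu, hc⟩ := h
  obtain ⟨u', hu', hc'⟩ := h'
  refine ⟨u.trans u'.symm, fun h => ?_, fun i x => ?_⟩
  · rw [LinearIsometryEquiv.trans_apply, LinearIsometryEquiv.symm_apply_eq]
    exact Subtype.ext ((hu h).trans (hu' h).symm)
  · rw [LinearIsometryEquiv.trans_apply, LinearIsometryEquiv.symm_apply_eq, hc, hc',
      LinearIsometryEquiv.trans_apply, LinearIsometryEquiv.apply_symm_apply]

end Uniqueness

/-! ### Ranges of multi-analytic inner operators -/

namespace MultiAnalyticInner

variable {ι : Type} {Y : Type u} [NormedAddCommGroup Y] [InnerProductSpace ℂ Y]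

/-- The range of a multi-analytic inner operator. -/
def rangeSubspace (M : MultiAnalyticInner ι Y) : InvariantSubspace ι Y :=
  ⟨LinearMap.range M.M.toLinearMap, M.M.isometry.isClosedEmbedding.isClosed_range,
    fun i _ ⟨x, hx⟩ => ⟨creation i x, (M.comm i x).trans (congrArg _ hx)⟩⟩

/-- The range of `M` is generated by the values of its symbol under the creation operators, and the
range of `M'` is closed and invariant. -/
theorem range_le_of_symbol_eq {M M' : MultiAnalyticInner ι Y} {v : M.Dom → M'.Dom}
    (hv : ∀ d, M.symbol d = M'.symbol (v d)) :
    LinearMap.range M.M.toLinearMap ≤ LinearMap.range M'.M.toLinearMap := by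
  rintro _ ⟨x, rfl⟩
  refine mem_of_forall_tens_mem (S := M'.rangeSubspace.1.comap M.M.toLinearMap)
    (M'.rangeSubspace.2.1.preimage M.M.continuous) (fun α d => ?_) x
  change M.M (tens α d) ∈ M'.rangeSubspace.1
  induction α with
  | nil => exact ⟨vac ι M'.Dom (v d), (hv d).symm⟩
  | cons i α ih =>
    rw [← creation_tens, M.comm]
    exact M'.rangeSubspace.2.2 i _ ih

theorem rangeSubspace_eq_of_equiv {M M' : MultiAnalyticInner ι Y} (h : M ≈ M') :
    M.rangeSubspace = M'.rangeSubspace := by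
  obtain ⟨v', hv'⟩ := Setoid.symm h
  obtain ⟨v, hv⟩ := h
  exact Subtype.ext (le_antisymm (range_le_of_symbol_eq hv) (range_le_of_symbol_eq hv'))

/-- If `M` and `M'` have the same range, then every `M (e_0 ⊗ d)` is orthogonal to the translates
of that range, and hence of the form `M' (e_0 ⊗ d')`. -/
theorem exists_symbol_eq {M M' : MultiAnalyticInner ι Y}
    (h : LinearMap.range M.M.toLinearMap = LinearMap.range M'.M.toLinearMap) (d : M.Dom) :
    ∃ d', M.symbol d = M'.symbol d' := by
  obtain ⟨x, hx⟩ := h.le ⟨vac ι M.Dom d, rfl⟩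
  replace hx : M'.M x = M.M (vac ι M.Dom d) := hx
  refine ⟨x [], ?_⟩
  have hx' : x = vac ι M'.Dom (x []) := eq_vac_of_inner_creation_eq_zero fun i z => by
    obtain ⟨y, hy⟩ := h.ge ⟨z, rfl⟩
    replace hy : M.M y = M'.M z := hy
    rw [← M'.M.inner_map_map, M'.comm, hx, ← hy, ← M.comm, M.M.inner_map_map,
      inner_eq_zero_symm.1 (inner_vac_creation d i y)]
  change M.M (vac ι M.Dom d) = M'.M (vac ι M'.Dom (x []))
  rw [← hx', hx]

theorem norm_symbol (M : MultiAnalyticInner ι Y) (d : M.Dom) : ‖M.symbol d‖ = ‖d‖ :=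
  (M.M.norm_map _).trans (norm_vac d)

theorem symbol_injective (M : MultiAnalyticInner ι Y) : Function.Injective M.symbol :=
  (AddMonoidHomClass.isometry_of_norm M.symbol M.norm_symbol).injective

/-- Multi-analytic inner operators with the same range are equivalent. -/
theorem equiv_of_range_eq {M M' : MultiAnalyticInner ι Y}
    (h : LinearMap.range M.M.toLinearMap = LinearMap.range M'.M.toLinearMap) : M ≈ M' := by
  choose v hv using exists_symbol_eq h
  let v' : M.Dom →ₗᵢ[ℂ] M'.Dom :=
    { toFun := v
      map_add' := fun x y => M'.symbol_injective (by rw [← hv, map_add, map_add, hv, hv])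
      map_smul' := fun c x => M'.symbol_injective (by
        rw [← hv, map_smul, RingHom.id_apply, map_smul, hv])
      norm_map' := fun x => by
        change ‖v x‖ = ‖x‖
        rw [← M'.norm_symbol, ← hv, M.norm_symbol] }
  have hsurj : Function.Surjective v' := fun d' => by
    obtain ⟨d, hd⟩ := exists_symbol_eq h.symm d'
    exact ⟨d, M'.symbol_injective ((hv d).symm.trans hd.symm)⟩
  exact ⟨LinearIsometryEquiv.ofSurjective v' hsurj, hv⟩

theorem equiv_iff_rangeSubspace_eq {M M' : MultiAnalyticInner ι Y} :
    M ≈ M' ↔ M.rangeSubspace = M'.rangeSubspace :=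
  ⟨rangeSubspace_eq_of_equiv, fun h => equiv_of_range_eq (congrArg Subtype.val h)⟩

end MultiAnalyticInner

/-! ### The invariant subspace of a subisometric lifting -/

namespace SubisometricLifting

variable {ι : Type} {H : Type u} [NormedAddCommGroup H] [InnerProductSpace ℂ H] [CompleteSpace H]
  {C : RowContraction ι H}

/-- The intertwiners are arbitrary, so the case `E = E'` shows that the subspace does not depend on
the choice of `W`. -/
theorem equiv_iff_invariantSubspace_eq {E E' : SubisometricLifting C} (w : Intertwiner E.1)
    (w' : Intertwiner E'.1) : E ≈ E' ↔ w.invariantSubspace = w'.invariantSubspace :=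
  ⟨fun h => le_antisymm (w'.invariantSubspace_le w (Setoid.symm h)) (w.invariantSubspace_le w' h),
    fun h => w.hasModel.unitarilyEquivalent (h ▸ w'.hasModel)⟩

/-- The invariant subspace of a subisometric lifting. -/
def invariantSubspace (E : SubisometricLifting C) : InvariantSubspace ι C.Defect :=
  E.2.some.charFun.rangeSubspace

theorem coe_invariantSubspace (E : SubisometricLifting C) (w : Intertwiner E.1) :
    E.invariantSubspace.1 = w.invariantSubspace :=
  E.2.some.range_charFun.trans ((equiv_iff_invariantSubspace_eq _ w).1 (Setoid.refl E))

theorem rangeSubspace_charFun (E : SubisometricLifting C) (w : Intertwiner E.1) :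
    w.charFun.rangeSubspace = E.invariantSubspace :=
  Subtype.ext (w.range_charFun.trans (E.coe_invariantSubspace w).symm)

theorem equiv_iff {E E' : SubisometricLifting C} :
    E ≈ E' ↔ E.invariantSubspace = E'.invariantSubspace := by
  rw [equiv_iff_invariantSubspace_eq E.2.some E'.2.some, ← E.coe_invariantSubspace,
    ← E'.coe_invariantSubspace]
  exact Subtype.ext_iff.symm

/-- Every invariant subspace belongs to a subisometric lifting. -/
theorem exists_hasModel_and_invariantSubspace_eq (N : InvariantSubspace ι C.Defect) :
    ∃ E : SubisometricLifting C, E.1.HasModel N.1 ∧ E.invariantSubspace = N := by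
  obtain ⟨E, w, hE, hw⟩ := exists_lifting_hasModel C N.1 N.2.1 N.2.2
  have hcoe := coe_invariantSubspace ⟨E, ⟨w⟩⟩ w
  have hmodel : modelSpace C w.invariantSubspace = modelSpace C N.1 := by
    ext x
    rw [hw, ← w.range_spaceIsometry]
    rfl
  -- The complement of the subspace is the slice of the model space with zero `H`-component. Taking
  -- complements again recovers the subspace, since both are closed.
  have horth : w.invariantSubspaceᗮ = N.1ᗮ := by
    ext z
    exact SetLike.ext_iff.1 hmodel (WithLp.toLp 2 (0, z))
  have hclosed : IsClosed (w.invariantSubspace : Set (Fock ι C.Defect)) :=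
    Submodule.isClosed_orthogonal _
  refine ⟨⟨E, ⟨w⟩⟩, hE, Subtype.ext (hcoe.trans ?_)⟩
  rw [← hclosed.submodule_topologicalClosure_eq, ← Submodule.orthogonal_orthogonal_eq_closure,
    horth, Submodule.orthogonal_orthogonal_eq_closure, N.2.1.submodule_topologicalClosure_eq]

theorem hasModel_iff (E : SubisometricLifting C) (N : InvariantSubspace ι C.Defect) :
    E.1.HasModel N.1 ↔ E.invariantSubspace = N := by
  constructor
  · intro h
    -- Some `E'` has model `N` and invariant subspace `N`. Sharing that model makes `E` equivalent
    -- to `E'`, so their subspaces agree.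
    obtain ⟨E', hE', rfl⟩ := exists_hasModel_and_invariantSubspace_eq N
    exact equiv_iff.1 (h.unitarilyEquivalent hE')
  · rintro rfl
    rw [E.coe_invariantSubspace E.2.some]
    exact E.2.some.hasModel

/-- The correspondence between subisometric liftings and invariant subspaces. -/
def quotientEquiv (C : RowContraction ι H) :
    Quotient (liftingSetoid C) ≃ InvariantSubspace ι C.Defect :=
  Equiv.ofBijective (Quotient.lift invariantSubspace fun _ _ h => equiv_iff.1 h) (by
    constructor
    · rintro ⟨E⟩ ⟨E'⟩ h
      exact Quotient.sound (equiv_iff.2 h)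
    · intro N
      obtain ⟨E, -, hE⟩ := exists_hasModel_and_invariantSubspace_eq N
      exact ⟨⟦E⟧, hE⟩)

theorem quotientEquiv_mk (E : SubisometricLifting C) : quotientEquiv C ⟦E⟧ = E.invariantSubspace :=
  rfl

end SubisometricLifting

/-- The correspondence between multi-analytic inner operators and invariant subspaces. -/
def multiAnalyticQuotientEquiv {ι : Type} {H : Type u} [NormedAddCommGroup H]
    [InnerProductSpace ℂ H] [CompleteSpace H] (C : RowContraction ι H) :
    Quotient (multiAnalyticSetoid ι C.Defect) ≃ InvariantSubspace ι C.Defect :=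
  Equiv.ofBijective (Quotient.lift MultiAnalyticInner.rangeSubspace fun _ _ h =>
      MultiAnalyticInner.rangeSubspace_eq_of_equiv h) (by
    constructor
    · rintro ⟨M⟩ ⟨M'⟩ h
      exact Quotient.sound (MultiAnalyticInner.equiv_iff_rangeSubspace_eq.2 h)
    · intro N
      -- The operator with range `N` is the characteristic function of the lifting constructed from
      -- `N`.
      obtain ⟨E, -, hE⟩ := SubisometricLifting.exists_hasModel_and_invariantSubspace_eq N
      exact ⟨⟦E.2.some.charFun⟧, hE⟩)

end Subisometric

end

/-! ### The three correspondences -/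

open Subisometric in
theorem theorem4p1p6 {ι : Type} [Countable ι] {H : Type u} [NormedAddCommGroup H]
    [InnerProductSpace ℂ H] [CompleteSpace H] (C : RowContraction ι H) :
    ∃ (F : Quotient (liftingSetoid C) ≃ InvariantSubspace ι C.Defect)
      (G : Quotient (multiAnalyticSetoid ι C.Defect) ≃ InvariantSubspace ι C.Defect)
      (K : Quotient (liftingSetoid C) ≃ Quotient (multiAnalyticSetoid ι C.Defect)),
      (∀ (E : SubisometricLifting C) (w : Intertwiner E.1), (F ⟦E⟧).1 = w.invariantSubspace) ∧
      (∀ (E : SubisometricLifting C) (N : InvariantSubspace ι C.Defect),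
        F.symm N = ⟦E⟧ ↔ E.1.HasModel N.1) ∧
      (∀ M : MultiAnalyticInner ι C.Defect, (G ⟦M⟧).1 = LinearMap.range M.M.toLinearMap) ∧
      (∀ (E : SubisometricLifting C) (w : Intertwiner E.1), K ⟦E⟧ = ⟦w.charFun⟧) ∧
      (∀ x, G (K x) = F x) ∧
      (∀ (E E' : SubisometricLifting C) (w : Intertwiner E.1) (w' : Intertwiner E'.1),
        E.1.UnitarilyEquivalent E'.1 ↔ w.charFun ≈ w'.charFun) := by
  -- With `K = G⁻¹ ∘ F` compatibility is automatic, and the formula for `K` reduces to the range of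
  -- `w.charFun` being the invariant subspace of `E`.
  refine ⟨SubisometricLifting.quotientEquiv C, multiAnalyticQuotientEquiv C,
    (SubisometricLifting.quotientEquiv C).trans (multiAnalyticQuotientEquiv C).symm,
    fun E w => E.coe_invariantSubspace w, fun E N => ?_, fun M => rfl, fun E w => ?_,
    fun x => (multiAnalyticQuotientEquiv C).apply_symm_apply _, fun E E' w w' => ?_⟩
  · rw [SubisometricLifting.hasModel_iff, Equiv.symm_apply_eq,
      SubisometricLifting.quotientEquiv_mk, eq_comm]
  · rw [Equiv.trans_apply, Equiv.symm_apply_eq]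
    exact (E.rangeSubspace_charFun w).symm
  · rw [MultiAnalyticInner.equiv_iff_rangeSubspace_eq, E.rangeSubspace_charFun,
      E'.rangeSubspace_charFun]
    exact SubisometricLifting.equiv_iff
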